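/- For $z=x+i\xi\in\mathbb{C}$ and $g:\mathbb{R}\to\mathbb{C}$ put $\pi(z)g(t)=e^{2\pi i\xi t}g(t-x)$, and for $f,g\in L^2(\mathbb{R})$ let $V_gf(z)=\langle f,\pi(z)g\rangle=\int_{\mathbb{R}}f(t)\overline{g(t-x)}e^{-2\pi i\xi t}\,dt$ be the short-time Fourier transform. Let $Q_R=\{x+i\xi\in\mathbb{C}:\max(|x|,|\xi|)\le R/2\}$. A measurable set $\Omega\subset\mathbb{C}$ is called $(\gamma,R)$-dense if $$\gamma=\inf_{z\in\mathbb{C}}\frac{|\Omega\cap(z+Q_R)|}{R^2}>0 .$$ It is called a planar set of sampling (for $g$) if there is a constant $C>0$ with $$\int_{\mathbb{C}}|V_gf(z)|^2\,dz\le C\int_{\Omega}|V_gf(z)|^2\,dz\qquad\text{for all } f\in L^2(\mathbb{R});$$ the infimum $C(\Omega)$ of these $C$ is its sampling constant. A set $\Gamma\subset\mathbb{C}$ is uniformly separated if the distances between its distinct points are bounded below by a positive constant, and relatively uniformly separated if it is a finite union of uniformly separated sets. Let $0\neq g\in L^2(\mathbb{R})$ be such that every relatively uniformly separated $\Gamma\subset\mathbb{C}$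 generates a Gabor Bessel sequence, i.e. there is $B>0$ with $\sum_{z\in\Gamma}|\langle f,\pi(z)g\rangle|^2\le B\|f\|_2^2$ for all $f\in L^2(\mathbb{R})$. Let $R>2$ be such that every $(\gamma,R)$-dense set, for every $\gamma>0$, is a planar set of sampling for $g$. Then there is no constant $K>0$ such that $C(\Omega)\le K\gamma^{-1}$ for all $\gamma>0$ and all $(\gamma,R)$-dense sets $\Omega$. In particular, for every $K>0$ and every $\delta>0$ there are $\gamma\in(0,\delta)$, a $(\gamma,R)$-dense set $\Omega$ and $\varepsilon>0$ (depending on $K$, $\delta$ and $\Omega$) such that $C(\Omega)\ge K\gamma^{-1-\varepsilon}$. -/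

import Mathlib

noncomputable section

namespace PlanarSampling

open MeasureTheory
open scoped ENNReal ComplexConjugate

/-- The Hilbert space `L²(ℝ)` of complex-valued functions. -/
abbrev L2 : Type := Lp ℂ 2 (volume : Measure ℝ)

/-- The time-frequency shift `π(z)g(t) = e^{2πiξt} g(t - x)`, where `z = x + iξ`. -/
def timeFreqShift (z : ℂ) (g : ℝ → ℂ) : ℝ → ℂ := fun t =>
  Complex.exp (2 * Real.pi * Complex.I * z.im * t) * g (t - z.re)

/-- The short-time Fourier transform `V_g f(z) = ⟨f, π(z)g⟩` (linear in `f`). -/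
def stft (g f : L2) (z : ℂ) : ℂ :=
  ∫ t : ℝ, f t * conj (timeFreqShift z g t)

/-- The closed square `Q_R` of side length `R`, centred at the origin. -/
def square (R : ℝ) : Set ℂ := {w | max |w.re| |w.im| ≤ R / 2}

/-- `Ω` is `(γ, R)`-dense: `Ω` is measurable and
`γ = inf_z |Ω ∩ (z + Q_R)| / R²` is positive. -/
def IsGammaDense (γ R : ℝ) (Ω : Set ℂ) : Prop :=
  MeasurableSet Ω ∧
    γ = ⨅ z : ℂ, (volume : Measure ℂ).real (Ω ∩ (fun w => z + w) '' square R) / R ^ 2 ∧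
    0 < γ

/-- `C` is a sampling bound of `Ω` for the window `g`:
`∫_ℂ |V_g f|² ≤ C ∫_Ω |V_g f|²` for all `f ∈ L²(ℝ)`. -/
def IsSamplingBound (g : L2) (Ω : Set ℂ) (C : ℝ) : Prop :=
  ∀ f : L2, ∫⁻ z : ℂ, ‖stft g f z‖ₑ ^ 2 ≤
    ENNReal.ofReal C * ∫⁻ z in Ω, ‖stft g f z‖ₑ ^ 2

/-- `Ω` is a planar set of sampling for the window `g`. -/
def IsPlanarSamplingSet (g : L2) (Ω : Set ℂ) : Prop :=
  ∃ C : ℝ, 0 < C ∧ IsSamplingBound g Ω C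

/-- The sampling constant of a planar set of sampling: the infimum of its sampling bounds. -/
def samplingConstant (g : L2) (Ω : Set ℂ) : ℝ :=
  sInf {C : ℝ | 0 < C ∧ IsSamplingBound g Ω C}

/-- Distinct points of `Γ` have distance bounded below by a positive constant. -/
def IsUniformlySeparated (Γ : Set ℂ) : Prop :=
  ∃ δ : ℝ, 0 < δ ∧ Γ.Pairwise fun z y => δ ≤ dist z y

/-- `Γ` is a finite union of uniformly separated sets. -/
def IsRelativelyUniformlySeparated (Γ : Set ℂ) : Prop :=
  ∃ (n : ℕ) (s : Fin n → Set ℂ), (∀ i, IsUniformlySeparated (s i)) ∧ Γ = ⋃ i, s i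

/-- `{π(z)g}_{z ∈ Γ}` is a Gabor Bessel sequence:
`∑_{z ∈ Γ} |⟨f, π(z)g⟩|² ≤ B ‖f‖²` for all `f ∈ L²(ℝ)`. -/
def IsGaborBessel (g : L2) (Γ : Set ℂ) : Prop :=
  ∃ B : ℝ, 0 < B ∧ ∀ f : L2,
    ∑' z : Γ, ‖stft g f z‖ₑ ^ 2 ≤ ENNReal.ofReal (B * ‖f‖ ^ 2)

end PlanarSampling

end

noncomputable section

namespace PlanarSampling

open MeasureTheory
open scoped ENNReal ComplexConjugate InnerProductSpace Topology

/-! The bad sets are small squares of side `r` attached to the points of the lattice `2ℤ + iℤ`. A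
cell of this lattice has area 2 > 1, so by the density principle for Gabor systems the lattice orbit
of `g` is not a frame. Hence for every `A > 0` some `f` satisfies `‖T f‖² < A‖f‖²`, where `T` is the
analysis operator, bounded by the Bessel hypothesis. By density `f` may be taken continuous with
compact support; then `w ↦ π(w)f` is continuous at 0 and the estimate persists for all shifts from a
small square. Integrating it over the square bounds the energy of `V_g f` on `Ω` by `A‖f‖²r²`, while
Moyal's identity gives total energy `‖f‖²‖g‖²`. So `C(Ω) ≥ ‖g‖²/(A r²)`. Since `R > 2`, every
translate of `Q_R` contains a whole small square, so `γ ≥ r²/R²` and `C(Ω)γ ≥ ‖g‖²/(A R²)`, which is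
arbitrarily large because `A` is.

The failure of the frame property comes from computing `⟨g, x⟩` twice for the canonical dual window
`x`: `exists_dual_window` gives modulus at most 1, while `inner_eq_two_of_dual` gives the lattice
area 2. -/

theorem enorm_sq_eq_ofReal (c : ℂ) : ‖c‖ₑ ^ 2 = ENNReal.ofReal (‖c‖ ^ 2) := by
  rw [ENNReal.ofReal_pow (norm_nonneg _), ofReal_norm]

/-! ### Abstract frames generated by a group orbit -/

section Frames

variable {H : Type*} [NormedAddCommGroup H] [InnerProductSpace ℂ H] {ι : Type*}

/-- A Bessel sequence in a Hilbert space has a bounded analysis operator. -/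
theorem exists_analysisOperator (e : ι → H) (B : ℝ)
    (hB : ∀ f : H, ∑' i, ‖⟪e i, f⟫_ℂ‖ₑ ^ 2 ≤ ENNReal.ofReal (B * ‖f‖ ^ 2)) :
    ∃ T : H →L[ℂ] lp (fun _ : ι => ℂ) 2,
      (∀ f i, T f i = ⟪e i, f⟫_ℂ) ∧
      ∀ f, ∑' i, ‖⟪e i, f⟫_ℂ‖ₑ ^ 2 = ENNReal.ofReal (‖T f‖ ^ 2) := by
  have hsum : ∀ f, Summable fun i => ‖⟪e i, f⟫_ℂ‖ ^ 2 := fun f => by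
    have h : ∑' i, ENNReal.ofReal (‖⟪e i, f⟫_ℂ‖ ^ 2) ≠ ∞ := by
      simp_rw [← enorm_sq_eq_ofReal]
      exact ((hB f).trans_lt ENNReal.ofReal_lt_top).ne
    exact (ENNReal.summable_toReal h).congr fun i => ENNReal.toReal_ofReal (by positivity)
  have hmem : ∀ f, Memℓp (fun i => ⟪e i, f⟫_ℂ) 2 := fun f =>
    memℓp_gen (by simpa using hsum f)
  let T₀ : H →ₗ[ℂ] lp (fun _ : ι => ℂ) 2 :=
    { toFun := fun f => ⟨fun i => ⟪e i, f⟫_ℂ, hmem f⟩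
      map_add' := fun f h => by
        ext i; exact inner_add_right _ _ _
      map_smul' := fun c f => by
        ext i; exact inner_smul_right _ _ _ }
  have hnorm : ∀ f, ‖T₀ f‖ ^ 2 = ∑' i, ‖⟪e i, f⟫_ℂ‖ ^ 2 := fun f => by
    have := lp.norm_rpow_eq_tsum (p := 2) (by simp) (T₀ f)
    simpa [T₀] using this
  have hE : ∀ f, ∑' i, ‖⟪e i, f⟫_ℂ‖ₑ ^ 2 = ENNReal.ofReal (‖T₀ f‖ ^ 2) := fun f => by
    rw [hnorm, ENNReal.ofReal_tsum_of_nonneg (fun _ => by positivity) (hsum f)]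
    simp_rw [enorm_sq_eq_ofReal]
  refine ⟨T₀.mkContinuous (Real.sqrt (max B 0)) fun f => ?_, fun f i => rfl, hE⟩
  have h1 := hB f
  rw [hE f] at h1
  -- `B` carries no sign assumption, hence the truncation at 0.
  have h2 : ‖T₀ f‖ ^ 2 ≤ max B 0 * ‖f‖ ^ 2 := by
    have h3 : ENNReal.ofReal (‖T₀ f‖ ^ 2) ≤ ENNReal.ofReal (max B 0 * ‖f‖ ^ 2) :=
      h1.trans (ENNReal.ofReal_le_ofReal (by gcongr; exact le_max_left _ _))
    exact (ENNReal.ofReal_le_ofReal_iff (by positivity)).1 h3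
  refine le_of_sq_le_sq ?_ (by positivity)
  rwa [mul_pow, Real.sq_sqrt (le_max_right _ _)]

variable [CompleteSpace H]

/-- If the orbit `(U i g)` of a family of isometries acting additively on `g` is a frame
with analysis operator `T`, then its canonical dual is the orbit of a vector `x` with `|⟪g, x⟫| ≤ 1`. -/
theorem exists_dual_window [AddGroup ι] (U : ι → H →ₗᵢ[ℂ] H) (g : H)
    (hU : ∀ i j, U i (U j g) = U (i + j) g) (hU0 : U 0 g = g)
    (T : H →L[ℂ] lp (fun _ : ι => ℂ) 2) (hT : ∀ f i, T f i = ⟪U i g, f⟫_ℂ)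
    {A : ℝ} (hA : 0 < A) (hlow : ∀ f, A * ‖f‖ ^ 2 ≤ ‖T f‖ ^ 2) :
    ∃ x : H, ‖⟪g, x⟫_ℂ‖ ≤ 1 ∧
      ∀ f, HasSum (fun i => ⟪U i g, f⟫_ℂ * ⟪f, U i x⟫_ℂ) ⟪f, f⟫_ℂ := by
  classical
  set S : H →L[ℂ] H := T.adjoint ∘L T with hS
  have hSS : ∀ f h, ⟪S f, h⟫_ℂ = ⟪T f, T h⟫_ℂ := fun f h => by
    simp [hS, ContinuousLinearMap.adjoint_inner_left]
  have hSS' : ∀ f h, ⟪f, S h⟫_ℂ = ⟪T f, T h⟫_ℂ := fun f h => by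
    simp [hS, ContinuousLinearMap.adjoint_inner_right]
  -- The lower frame bound makes the frame operator `S = T*T` coercive, hence invertible.
  have hunit : IsUnit S := by
    refine ContinuousLinearMap.isUnit_of_forall_le_norm_inner_map S (c := ⟨A, hA.le⟩) hA
      fun f => ?_
    rw [hSS, inner_self_eq_norm_sq_to_K, norm_pow]
    have h := (mul_comm (‖f‖ ^ 2) A).trans_le (hlow f)
    rw [RCLike.norm_ofReal, abs_norm]
    exact h
  have hsingle : ∀ i, T.adjoint (lp.single 2 i (1 : ℂ)) = U i g := fun i => by
    refine ext_inner_right ℂ fun h => ?_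
    rw [ContinuousLinearMap.adjoint_inner_left, lp.inner_single_left, hT]
    simp
  have hSsum : ∀ f, HasSum (fun i => ⟪U i g, f⟫_ℂ • U i g) (S f) := fun f => by
    have h1 := lp.hasSum_single (p := 2) (by simp) (T f)
    have h2 := h1.mapL T.adjoint
    have h3 : (fun i => T.adjoint (lp.single 2 i (T f i))) = fun i => ⟪U i g, f⟫_ℂ • U i g := by
      funext i
      conv_rhs => rw [← hsingle i, ← map_smul, ← lp.single_smul, hsingle i, smul_eq_mul, mul_one,
        ← hT]
    rwa [h3] at h2
  -- Translating the summation index in the frame expansion shows that `S` commutes with the orbit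
  -- maps; this is why the canonical dual is again an orbit.
  have hcomm : ∀ i f, S (U i f) = U i (S f) := fun i f => by
    have h1 := (hSsum f).mapL (U i).toContinuousLinearMap
    have h2 := (Equiv.addLeft i).hasSum_iff.2 (hSsum (U i f))
    have h3 : ((fun j => ⟪U j g, U i f⟫_ℂ • U j g) ∘ Equiv.addLeft i) =
        fun j => (U i).toContinuousLinearMap (⟪U j g, f⟫_ℂ • U j g) := by
      funext j
      simp [← hU]
    rw [h3] at h2
    exact h2.unique h1
  obtain ⟨u, hu⟩ := hunit
  have hinv : ∀ f, S ((↑u⁻¹ : H →L[ℂ] H) f) = f := fun f => by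
    rw [← hu, ← mul_apply_eq_comp, Units.mul_inv]; rfl
  refine ⟨(↑u⁻¹ : H →L[ℂ] H) g, ?_, fun f => ?_⟩
  · set x := (↑u⁻¹ : H →L[ℂ] H) g
    -- With `S x = g`, the number `⟪g, x⟫` equals `‖T x‖²` and is also the coordinate of `T x` at 0.
    -- Thus `‖T x‖² ≤ ‖T x‖`, which forces `‖T x‖ ≤ 1`.
    have h1 : ⟪g, x⟫_ℂ = ((‖T x‖ ^ 2 : ℝ) : ℂ) := by
      have h : ⟪S x, x⟫_ℂ = ((‖T x‖ ^ 2 : ℝ) : ℂ) := by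
        rw [hSS, inner_self_eq_norm_sq_to_K]; simp
      rwa [hinv g] at h
    have h2 : ‖⟪g, x⟫_ℂ‖ ≤ ‖T x‖ := by
      have := lp.norm_apply_le_norm (p := 2) (by simp) (T x) 0
      rwa [hT, hU0] at this
    rw [h1] at h2 ⊢
    simp only [Complex.norm_real, Real.norm_eq_abs, abs_pow, abs_norm] at h2 ⊢
    nlinarith [norm_nonneg (T x)]
  · set x := (↑u⁻¹ : H →L[ℂ] H) g
    set y := (↑u⁻¹ : H →L[ℂ] H) f
    have h1 : ⟪f, f⟫_ℂ = ⟪y, S f⟫_ℂ := by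
      rw [hSS', ← hSS, hinv]
    have h2 := (hSsum f).mapL (innerSL ℂ y)
    rw [h1]
    have h3 : ∀ i, ⟪y, U i g⟫_ℂ = ⟪f, U i x⟫_ℂ := fun i => by
      have h4 : S (U i x) = U i g := by rw [hcomm, hinv]
      rw [← h4, hSS', ← hSS, hinv]
    simpa only [map_smul, innerSL_apply_apply, smul_eq_mul, h3] using h2

end Frames

/-! ### Time-frequency shifts on `L²(ℝ)` -/

theorem norm_exp_two_pi_I_mul (a b : ℝ) :
    ‖Complex.exp (2 * Real.pi * Complex.I * a * b)‖ = 1 := by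
  have : (2 * Real.pi * Complex.I * a * b : ℂ) = ((2 * Real.pi * a * b : ℝ) : ℂ) * Complex.I := by
    push_cast; ring
  rw [this, Complex.norm_exp_ofReal_mul_I]

theorem norm_exp_neg_two_pi_I_mul (a b : ℝ) :
    ‖Complex.exp (-(2 * Real.pi * Complex.I * a * b))‖ = 1 := by
  rw [Complex.exp_neg, norm_inv, norm_exp_two_pi_I_mul, inv_one]

theorem norm_timeFreqShift (z : ℂ) (g : ℝ → ℂ) (t : ℝ) :
    ‖timeFreqShift z g t‖ = ‖g (t - z.re)‖ := by
  rw [timeFreqShift, norm_mul, norm_exp_two_pi_I_mul, one_mul]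

theorem timeFreqShift_congr_ae (z : ℂ) {g h : ℝ → ℂ} (hgh : g =ᵐ[volume] h) :
    timeFreqShift z g =ᵐ[volume] timeFreqShift z h := by
  have := (measurePreserving_sub_right volume z.re).quasiMeasurePreserving.ae_eq_comp hgh
  filter_upwards [this] with t ht
  simp only [Function.comp_apply] at ht
  simp [timeFreqShift, ht]

theorem memLp_timeFreqShift (z : ℂ) {g : ℝ → ℂ} {p : ℝ≥0∞} (hg : MemLp g p volume) :
    MemLp (timeFreqShift z g) p volume := by
  have h1 : MemLp (fun t => g (t - z.re)) p volume :=
    hg.comp_measurePreserving (measurePreserving_sub_right volume z.re)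
  refine h1.of_le (AEStronglyMeasurable.mul ?_ h1.aestronglyMeasurable)
    (ae_of_all _ fun t => (norm_timeFreqShift z g t).le)
  exact Continuous.aestronglyMeasurable (by fun_prop)

/-- The time-frequency shift `π(z)` as an isometry of `L²(ℝ)`. -/
def shiftL2 (z : ℂ) : L2 →ₗᵢ[ℂ] L2 where
  toFun f := (memLp_timeFreqShift z (Lp.memLp f)).toLp _
  map_add' f h := by
    rw [← MemLp.toLp_add]
    refine MemLp.toLp_congr _ _ ((timeFreqShift_congr_ae z (Lp.coeFn_add f h)).trans ?_)
    exact ae_of_all _ fun t => by simp [timeFreqShift, mul_add]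
  map_smul' c f := by
    rw [RingHom.id_apply, ← MemLp.toLp_const_smul]
    refine MemLp.toLp_congr _ _ ((timeFreqShift_congr_ae z (Lp.coeFn_smul c f)).trans ?_)
    exact ae_of_all _ fun t => by simp [timeFreqShift]; ring
  norm_map' f := by
    change ‖(memLp_timeFreqShift z (Lp.memLp f)).toLp (timeFreqShift z f)‖ = _
    rw [Lp.norm_toLp, Lp.norm_def]
    congr 1
    rw [← eLpNorm_comp_measurePreserving (Lp.aestronglyMeasurable f)
      (measurePreserving_sub_right volume z.re)]
    exact eLpNorm_congr_norm_ae (ae_of_all _ fun t => norm_timeFreqShift z f t)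

theorem coeFn_shiftL2 (z : ℂ) (f : L2) : shiftL2 z f =ᵐ[volume] timeFreqShift z f :=
  (memLp_timeFreqShift z (Lp.memLp f)).coeFn_toLp

theorem stft_eq_inner (g f : L2) (z : ℂ) : stft g f z = ⟪shiftL2 z g, f⟫_ℂ := by
  rw [L2.inner_def, stft]
  refine integral_congr_ae ?_
  filter_upwards [coeFn_shiftL2 z g] with t ht
  rw [RCLike.inner_apply, ht]

theorem timeFreqShift_timeFreqShift (z w : ℂ) (g : ℝ → ℂ) (t : ℝ) :
    timeFreqShift z (timeFreqShift w g) t =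
      Complex.exp (-(2 * Real.pi * Complex.I * w.im * z.re)) * timeFreqShift (z + w) g t := by
  simp only [timeFreqShift, ← mul_assoc, ← Complex.exp_add, Complex.add_re, Complex.add_im]
  congr 1
  · congr 1; push_cast; ring
  · congr 1; ring

theorem shiftL2_shiftL2 (z w : ℂ) (g : L2) :
    shiftL2 z (shiftL2 w g) =
      Complex.exp (-(2 * Real.pi * Complex.I * w.im * z.re)) • shiftL2 (z + w) g := by
  refine Lp.ext ?_
  filter_upwards [coeFn_shiftL2 z (shiftL2 w g), timeFreqShift_congr_ae z (coeFn_shiftL2 w g),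
    coeFn_shiftL2 (z + w) g,
    Lp.coeFn_smul (Complex.exp (-(2 * Real.pi * Complex.I * w.im * z.re))) (shiftL2 (z + w) g)]
    with t h1 h2 h3 h4
  rw [h1, h2, h4, Pi.smul_apply, h3, timeFreqShift_timeFreqShift, smul_eq_mul]

theorem shiftL2_zero (g : L2) : shiftL2 0 g = g := by
  refine Lp.ext ?_
  filter_upwards [coeFn_shiftL2 0 g] with t h1
  rw [h1]; simp [timeFreqShift]

/-- Up to a unimodular phase, an offset `w` of the sampling point can be moved from the window to
the signal. Sampling on a shifted lattice thus becomes lattice analysis of a shifted signal. -/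
theorem norm_stft_add (g f : L2) (z w : ℂ) :
    ‖stft g f (z + w)‖ = ‖⟪shiftL2 z g, shiftL2 (-w) f⟫_ℂ‖ := by
  have h1 := shiftL2_shiftL2 (-w) (z + w) g
  rw [show -w + (z + w) = z by ring] at h1
  rw [stft_eq_inner, ← (shiftL2 (-w)).inner_map_map, h1, inner_smul_left, norm_mul,
    RCLike.norm_conj, norm_exp_neg_two_pi_I_mul, one_mul]

/-! ### The Gabor system over `2ℤ + iℤ` -/

/-- The points of the lattice `2ℤ + iℤ`. -/
def latticePoint (p : ℤ × ℤ) : ℂ := ⟨2 * p.1, p.2⟩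

/-- The commutation phase is the exponential of an integer multiple of `2πi`, so the lattice shifts
compose with no cocycle, as `exists_dual_window` requires. -/
theorem shiftL2_latticePoint_add (p q : ℤ × ℤ) (g : L2) :
    shiftL2 (latticePoint p) (shiftL2 (latticePoint q) g) = shiftL2 (latticePoint (p + q)) g := by
  rw [shiftL2_shiftL2]
  have h1 : latticePoint p + latticePoint q = latticePoint (p + q) := by
    apply Complex.ext <;> simp [latticePoint]; ring
  have h2 : Complex.exp (-(2 * Real.pi * Complex.I * (latticePoint q).im * (latticePoint p).re))
      = 1 := by
    rw [Complex.exp_eq_one_iff]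
    refine ⟨-(q.2 * (2 * p.1)), ?_⟩
    simp [latticePoint]; ring
  rw [h1, h2, one_smul]

theorem latticePoint_zero : latticePoint 0 = 0 := by
  apply Complex.ext <;> simp [latticePoint]

theorem latticePoint_injective : Function.Injective latticePoint := by
  intro p q h
  have h1 := congrArg Complex.re h
  have h2 := congrArg Complex.im h
  simp only [latticePoint, mul_eq_mul_left_iff, OfNat.ofNat_ne_zero, or_false, Int.cast_inj]
    at h1 h2
  exact Prod.ext h1 h2

theorem isRelativelyUniformlySeparated_range_latticePoint :
    IsRelativelyUniformlySeparated (Set.range latticePoint) := by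
  refine ⟨1, fun _ => Set.range latticePoint, fun _ => ⟨1, one_pos, ?_⟩, (Set.iUnion_const _).symm⟩
  rintro _ ⟨p, rfl⟩ _ ⟨q, rfl⟩ hne
  rw [dist_eq_norm]
  have hpq : p ≠ q := fun h => hne (congrArg _ h)
  have key : ∀ m n : ℤ, m ≠ n → (1 : ℝ) ≤ |(m : ℝ) - n| := fun m n h => by
    exact_mod_cast Int.one_le_abs (sub_ne_zero.2 h)
  by_cases h : p.1 = q.1
  · have h2 : p.2 ≠ q.2 := fun h' => hpq (Prod.ext h h')
    exact (key _ _ h2).trans (Complex.abs_im_le_norm (latticePoint p - latticePoint q))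
  · refine le_trans ?_ (Complex.abs_re_le_norm (latticePoint p - latticePoint q))
    have := key _ _ h
    simp only [latticePoint, Complex.sub_re, ← mul_sub, abs_mul]
    norm_num
    linarith

/-- The analysis operator of the Gabor system over `2ℤ + iℤ`. -/
theorem exists_gaborAnalysis (g : L2)
    (hB : ∀ Γ : Set ℂ, IsRelativelyUniformlySeparated Γ → IsGaborBessel g Γ) :
    ∃ T : L2 →L[ℂ] lp (fun _ : ℤ × ℤ => ℂ) 2,
      (∀ f p, T f p = ⟪shiftL2 (latticePoint p) g, f⟫_ℂ) ∧
      ∀ f, ∑' p, ‖⟪shiftL2 (latticePoint p) g, f⟫_ℂ‖ₑ ^ 2 = ENNReal.ofReal (‖T f‖ ^ 2) := by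
  obtain ⟨B, -, hB⟩ := hB _ isRelativelyUniformlySeparated_range_latticePoint
  refine exists_analysisOperator (fun p => shiftL2 (latticePoint p) g) B fun f => ?_
  refine le_trans (le_of_eq ?_) (hB f)
  rw [← (Equiv.ofInjective _ latticePoint_injective).tsum_eq]
  simp [stft_eq_inner]

/-! ### Failure of the frame property -/

/-- Polarized Parseval identity on an interval. -/
theorem hasSum_conj_fourierCoeffOn_mul {a b : ℝ} {u v : ℝ → ℂ} (hab : a < b)
    (hu : MemLp u 2 (volume.restrict (Set.Ioc a b)))
    (hv : MemLp v 2 (volume.restrict (Set.Ioc a b))) :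
    HasSum (fun n => conj (fourierCoeffOn hab u n) * fourierCoeffOn hab v n)
      ((b - a)⁻¹ • ∫ t in a..b, conj (u t) * v t) := by
  have := Fact.mk (by linarith : 0 < b - a)
  rw [← add_sub_cancel a b] at hu hv
  have hu' := hu.memLp_liftIoc.haarAddCircle
  have hv' := hv.memLp_liftIoc.haarAddCircle
  have key := fourierBasis.hasSum_inner_mul_inner hu'.toLp hv'.toLp
  convert key using 1
  · rfl
  · funext n
    rw [← inner_conj_symm, ← fourierBasis.repr_apply_apply, ← fourierBasis.repr_apply_apply,
      fourierBasis_repr, fourierBasis_repr, fourierCoeff_congr_ae hu'.coeFn_toLp,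
      fourierCoeff_congr_ae hv'.coeFn_toLp]
    simp [fourierCoeff_liftIoc_eq]
  · nth_rw 2 [← add_sub_cancel a b]
    rw [← AddCircle.integral_liftIoc_eq_intervalIntegral, L2.inner_def,
      ← AddCircle.integral_haarAddCircle]
    apply integral_congr_ae
    filter_upwards [hu'.coeFn_toLp, hv'.coeFn_toLp] with x hx hy
    rw [hx, hy, RCLike.inner_apply, mul_comm]
    rfl

theorem fourierCoeffOn_add_one (c : ℝ) (u : ℝ → ℂ) (n : ℤ) :
    fourierCoeffOn (lt_add_one c) u n =
      ∫ t in Set.Ioc c (c + 1), Complex.exp (-(2 * Real.pi * Complex.I * n * t)) * u t := by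
  rw [fourierCoeffOn_eq_integral, add_sub_cancel_left, one_div, inv_one, one_smul,
    intervalIntegral.integral_of_le (by linarith)]
  refine integral_congr_ae (ae_of_all _ fun t => ?_)
  simp only [fourier_coe_apply, smul_eq_mul]
  congr 2
  push_cast
  ring

/-- The modulation step 1 matches the interval length 1, so for fixed `k` the pairings with the
indicator of the interval are exactly its Fourier coefficients. -/
theorem setIntegral_shiftL2_latticePoint (c : ℝ) (k n : ℤ) (g : L2) :
    ∫ t in Set.Ioc c (c + 1), shiftL2 (latticePoint (k, n)) g t =
      fourierCoeffOn (lt_add_one c) (fun t => g (t - 2 * k)) (-n) := by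
  rw [fourierCoeffOn_add_one]
  refine integral_congr_ae (ae_restrict_of_ae ?_)
  filter_upwards [coeFn_shiftL2 (latticePoint (k, n)) g] with t ht
  rw [ht, timeFreqShift]
  simp [latticePoint]

theorem memLp_two_translate (g : L2) (y : ℝ) (s : Set ℝ) :
    MemLp (fun t => g (t - y)) 2 (volume.restrict s) :=
  ((Lp.memLp g).comp_measurePreserving (measurePreserving_sub_right volume y)).restrict s

/-- If the orbit of `x` is dual to the orbit of `g`, then the periodizations of `conj g * x`
are normalized. -/
theorem hasSum_setIntegral_conj_mul_of_dual (g x : L2)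
    (hx : ∀ f, HasSum (fun p => ⟪shiftL2 (latticePoint p) g, f⟫_ℂ *
      ⟪f, shiftL2 (latticePoint p) x⟫_ℂ) ⟪f, f⟫_ℂ) (c : ℝ) :
    HasSum (fun k : ℤ => ∫ t in c..(c + 1), conj (g (t - 2 * k)) * x (t - 2 * k)) 1 := by
  set E := Set.Ioc c (c + 1)
  have hE : volume E ≠ ∞ := by simp [E]
  -- The dual expansion is tested on the indicator of a unit interval; summing over frequencies
  -- first, Parseval turns each fibre into an integral of `conj g * x` over a translated interval.
  set f : L2 := indicatorConstLp 2 measurableSet_Ioc hE 1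
  have hff : ⟪f, f⟫_ℂ = 1 := by
    rw [L2.inner_indicatorConstLp_one, setIntegral_congr_ae (g := fun _ => (1 : ℂ)) measurableSet_Ioc]
    · simp
    · filter_upwards [indicatorConstLp_coeFn_mem (p := 2) (hs := measurableSet_Ioc) (hμs := hE)
        (c := (1 : ℂ))] with t ht using ht
  have h1 := hx f
  rw [hff] at h1
  refine h1.prod_fiberwise fun k => ?_
  have h2 := hasSum_conj_fourierCoeffOn_mul (lt_add_one c)
    (memLp_two_translate g (2 * k) _) (memLp_two_translate x (2 * k) _)
  rw [add_sub_cancel_left, inv_one, one_smul] at h2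
  rw [← (Equiv.neg ℤ).hasSum_iff] at h2
  convert h2 using 1
  funext n
  rw [← inner_conj_symm _ f, L2.inner_indicatorConstLp_one, L2.inner_indicatorConstLp_one,
    setIntegral_shiftL2_latticePoint, setIntegral_shiftL2_latticePoint]
  rfl

/-- A period of the translations `2ℤ` consists of two unit intervals, each contributing 1 to `⟪g,
x⟫`. -/
theorem inner_eq_two_of_dual (g x : L2)
    (hx : ∀ f, HasSum (fun p => ⟪shiftL2 (latticePoint p) g, f⟫_ℂ *
      ⟪f, shiftL2 (latticePoint p) x⟫_ℂ) ⟪f, f⟫_ℂ) :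
    ⟪g, x⟫_ℂ = 2 := by
  have hint : Integrable (fun t => conj (g t) * x t) volume := by
    simpa only [RCLike.inner_apply, mul_comm] using L2.integrable_inner (𝕜 := ℂ) g x
  have hint' : ∀ y : ℝ, Integrable (fun t => conj (g (t - y)) * x (t - y)) volume := fun y =>
    hint.comp_sub_right y
  have h01 := (hasSum_setIntegral_conj_mul_of_dual g x hx 0).add
    (hasSum_setIntegral_conj_mul_of_dual g x hx (0 + 1))
  have h2 : HasSum (fun k : ℤ => ∫ t in Set.Ioc (0 + k • (2 : ℝ)) (0 + (k + 1) • (2 : ℝ)),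
      conj (g t) * x t) ⟪g, x⟫_ℂ := by
    have h3 := hasSum_integral_iUnion (f := fun t => conj (g t) * x t) (μ := volume)
      (fun k : ℤ => measurableSet_Ioc) (Set.pairwise_disjoint_Ioc_add_zsmul (0 : ℝ) (2 : ℝ))
      hint.integrableOn
    rw [iUnion_Ioc_add_zsmul (by norm_num), setIntegral_univ] at h3
    have h4 : ⟪g, x⟫_ℂ = ∫ t, conj (g t) * x t := by
      simp only [L2.inner_def, RCLike.inner_apply, mul_comm]
    rw [h4]
    exact h3
  rw [← (Equiv.neg ℤ).hasSum_iff] at h2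
  refine (h2.unique ?_).trans one_add_one_eq_two
  convert h01 using 1
  funext k
  rw [intervalIntegral.integral_add_adjacent_intervals (hint' _).intervalIntegrable
    (hint' _).intervalIntegrable,
    intervalIntegral.integral_comp_sub_right (fun t => conj (g t) * x t),
    intervalIntegral.integral_of_le (by linarith)]
  simp only [Function.comp_apply, Equiv.neg_apply]
  congr 3 <;> (simp; try ring)

/-- No Gabor system over `2ℤ + iℤ` is a frame. -/
theorem exists_norm_analysis_lt (g : L2) (T : L2 →L[ℂ] lp (fun _ : ℤ × ℤ => ℂ) 2)
    (hT : ∀ f p, T f p = ⟪shiftL2 (latticePoint p) g, f⟫_ℂ) {A : ℝ} (hA : 0 < A) :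
    ∃ f : L2, ‖T f‖ ^ 2 < A * ‖f‖ ^ 2 := by
  by_contra! hlow
  obtain ⟨x, hx1, hx⟩ := exists_dual_window (fun p => shiftL2 (latticePoint p)) g
    (fun p q => shiftL2_latticePoint_add p q g)
    (by simp only [latticePoint_zero, shiftL2_zero]) T hT hA hlow
  rw [inner_eq_two_of_dual g x hx] at hx1
  norm_num at hx1

/-- The near-kernel vectors of the analysis operator may be chosen continuous with compact
support. -/
theorem exists_hasCompactSupport_norm_analysis_lt (g : L2)
    (T : L2 →L[ℂ] lp (fun _ : ℤ × ℤ => ℂ) 2)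
    (hT : ∀ f p, T f p = ⟪shiftL2 (latticePoint p) g, f⟫_ℂ) {A : ℝ} (hA : 0 < A) :
    ∃ (f : L2) (f₀ : ℝ → ℂ), f =ᵐ[volume] f₀ ∧ Continuous f₀ ∧ HasCompactSupport f₀ ∧
      ‖T f‖ ^ 2 < A * ‖f‖ ^ 2 := by
  obtain ⟨f, hf⟩ := exists_norm_analysis_lt g T hT hA
  -- The strict inequality is an open condition, so it survives approximation by continuous
  -- compactly supported functions.
  have hopen : IsOpen {f : L2 | ‖T f‖ ^ 2 < A * ‖f‖ ^ 2} :=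
    isOpen_lt (by fun_prop) (by fun_prop)
  obtain ⟨ε, hε, hball⟩ := Metric.isOpen_iff.1 hopen f hf
  obtain ⟨f₀, hcs, hle, hcont, hmem⟩ := (Lp.memLp f).exists_hasCompactSupport_eLpNorm_sub_le
    (by simp) (ε := ENNReal.ofReal (ε / 2)) (by simpa using hε)
  refine ⟨hmem.toLp f₀, f₀, hmem.coeFn_toLp, hcont, hcs, hball ?_⟩
  rw [Metric.mem_ball, dist_comm, Lp.dist_def]
  have h1 : eLpNorm (f - hmem.toLp f₀ : ℝ → ℂ) 2 volume = eLpNorm (f - f₀ : ℝ → ℂ) 2 volume :=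
    eLpNorm_congr_ae (Filter.EventuallyEq.rfl.sub hmem.coeFn_toLp)
  rw [h1]
  exact (ENNReal.toReal_le_of_le_ofReal (by positivity) hle).trans_lt (by linarith)

/-! ### Plancherel, Moyal and continuity of the shifts -/

theorem stronglyMeasurable_fourierIntegral {F : ℝ → ℂ} (hF : StronglyMeasurable F) :
    StronglyMeasurable fun ξ : ℝ =>
      ∫ t : ℝ, Complex.exp (-(2 * Real.pi * Complex.I * ξ * t)) * F t := by
  refine StronglyMeasurable.integral_prod_right
    (f := fun ξ t : ℝ => Complex.exp (-(2 * Real.pi * Complex.I * ξ * t)) * F t) ?_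
  refine StronglyMeasurable.mul (Continuous.stronglyMeasurable (by fun_prop)) ?_
  exact hF.comp_measurable measurable_snd

/-- Parseval's identity for the samples `ξ + n / (b - a)` of the Fourier transform of a function
supported in `(a, b]`. -/
theorem tsum_enorm_sq_fourierIntegral {F : ℝ → ℂ} (hF2 : MemLp F 2 volume) {a b : ℝ}
    (hab : a < b) (hsupp : ∀ t, t ∉ Set.Ioc a b → F t = 0) (ξ : ℝ) :
    ∑' n : ℤ, ‖∫ t : ℝ, Complex.exp (-(2 * Real.pi * Complex.I *
        ((ξ + n • (b - a)⁻¹ : ℝ) : ℂ) * t)) * F t‖ₑ ^ 2 =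
      ENNReal.ofReal (b - a) * ∫⁻ t, ‖F t‖ₑ ^ 2 := by
  have hT : 0 < b - a := sub_pos.2 hab
  -- The offset `ξ` is absorbed as a modulation, so that the samples become Fourier coefficients of
  -- `G` on `(a, b]`, up to the factor `b - a`.
  set G : ℝ → ℂ := fun t => Complex.exp (-(2 * Real.pi * Complex.I * ξ * t)) * F t
  have hGnorm : ∀ t, ‖G t‖ = ‖F t‖ := fun t => by
    simp only [G, norm_mul, norm_exp_neg_two_pi_I_mul, one_mul]
  have hG2 : MemLp G 2 volume := by
    refine hF2.of_le (AEStronglyMeasurable.mul ?_ hF2.aestronglyMeasurable)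
      (ae_of_all _ fun t => (hGnorm t).le)
    exact Continuous.aestronglyMeasurable (by fun_prop)
  have hcoef : ∀ n : ℤ, ∫ t : ℝ, Complex.exp (-(2 * Real.pi * Complex.I *
        ((ξ + n • (b - a)⁻¹ : ℝ) : ℂ) * t)) * F t = ((b - a : ℝ) : ℂ) * fourierCoeffOn hab G n := by
    intro n
    rw [fourierCoeffOn_eq_integral, intervalIntegral.integral_of_le hab.le,
      setIntegral_eq_integral_of_forall_compl_eq_zero (fun t ht => by simp [G, hsupp t ht]),
      Complex.real_smul, ← mul_assoc, ← Complex.ofReal_mul, mul_one_div_cancel hT.ne',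
      Complex.ofReal_one, one_mul]
    refine integral_congr_ae (ae_of_all _ fun t => ?_)
    simp only [G, fourier_coe_apply, smul_eq_mul, ← mul_assoc, ← Complex.exp_add]
    congr 2
    push_cast
    simp
    ring
  have hs := hasSum_sq_fourierCoeffOn hab (hG2.restrict _)
  have hInt : Integrable (fun t => ‖F t‖ ^ 2) volume := hF2.integrable_norm_pow (by simp)
  have hval : ∫ t in a..b, ‖G t‖ ^ 2 = ∫ t, ‖F t‖ ^ 2 := by
    rw [intervalIntegral.integral_of_le hab.le,
      setIntegral_eq_integral_of_forall_compl_eq_zero (fun t ht => by simp [G, hsupp t ht])]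
    simp only [hGnorm]
  simp_rw [hcoef, enorm_sq_eq_ofReal, norm_mul, Complex.norm_real, mul_pow]
  rw [← ENNReal.ofReal_tsum_of_nonneg (fun _ => by positivity) (hs.summable.mul_left _),
    (hs.mul_left _).tsum_eq, hval, ← ofReal_integral_eq_lintegral_ofReal hInt
      (ae_of_all _ fun t => by positivity), ← ENNReal.ofReal_mul hT.le]
  congr 1
  rw [Real.norm_eq_abs, sq_abs, smul_eq_mul]
  field_simp

/-- Plancherel's identity for a compactly supported square integrable function. -/
theorem lintegral_enorm_sq_fourierIntegral {F : ℝ → ℂ} (hF : StronglyMeasurable F)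
    (hF2 : MemLp F 2 volume) {a b : ℝ} (hab : a < b) (hsupp : ∀ t, t ∉ Set.Ioc a b → F t = 0) :
    ∫⁻ ξ : ℝ, ‖∫ t : ℝ, Complex.exp (-(2 * Real.pi * Complex.I * ξ * t)) * F t‖ₑ ^ 2 =
      ∫⁻ t, ‖F t‖ₑ ^ 2 := by
  have hT : 0 < b - a := sub_pos.2 hab
  have hp : 0 < (b - a)⁻¹ := inv_pos.2 hT
  set h : ℝ → ℝ≥0∞ := fun ξ =>
    ‖∫ t : ℝ, Complex.exp (-(2 * Real.pi * Complex.I * ξ * t)) * F t‖ₑ ^ 2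
  have hmeas : Measurable h :=
    (stronglyMeasurable_fourierIntegral hF).measurable.enorm.pow_const 2
  have htrans : ∀ n : ℤ, ∫⁻ ξ in Set.Ioc (0 + n • (b - a)⁻¹) (0 + (n + 1) • (b - a)⁻¹), h ξ =
      ∫⁻ ξ in Set.Ioc 0 (b - a)⁻¹, h (ξ + n • (b - a)⁻¹) := by
    intro n
    have h1 := (measurePreserving_add_right volume (n • (b - a)⁻¹)).setLIntegral_comp_preimage
      (s := Set.Ioc (0 + n • (b - a)⁻¹) (0 + (n + 1) • (b - a)⁻¹)) measurableSet_Ioc hmeas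
    rw [← h1, Set.preimage_add_const_Ioc]
    congr 3 <;> simp [add_mul]
  -- The frequency line is folded onto one interval of length `1 / (b - a)`, on which the folded sum
  -- is constant by Parseval.
  calc ∫⁻ ξ, h ξ
      = ∑' n : ℤ, ∫⁻ ξ in Set.Ioc (0 + n • (b - a)⁻¹) (0 + (n + 1) • (b - a)⁻¹), h ξ := by
        rw [← lintegral_iUnion (fun n => measurableSet_Ioc)
          (Set.pairwise_disjoint_Ioc_add_zsmul 0 _), iUnion_Ioc_add_zsmul hp, setLIntegral_univ]
    _ = ∫⁻ ξ in Set.Ioc 0 (b - a)⁻¹, ∑' n : ℤ, h (ξ + n • (b - a)⁻¹) := by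
        simp_rw [htrans]
        exact (lintegral_tsum fun n => (hmeas.comp (measurable_add_const _)).aemeasurable).symm
    _ = ∫⁻ ξ in Set.Ioc 0 (b - a)⁻¹, ENNReal.ofReal (b - a) * ∫⁻ t, ‖F t‖ₑ ^ 2 := by
        refine lintegral_congr fun ξ => ?_
        exact tsum_enorm_sq_fourierIntegral hF2 hab hsupp ξ
    _ = ∫⁻ t, ‖F t‖ₑ ^ 2 := by
        rw [setLIntegral_const, Real.volume_Ioc, sub_zero, mul_right_comm,
          ← ENNReal.ofReal_mul hT.le, mul_inv_cancel₀ hT.ne', ENNReal.ofReal_one, one_mul]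

theorem measurable_stft (g f : L2) : Measurable (stft g f) := by
  refine StronglyMeasurable.measurable ?_
  refine StronglyMeasurable.integral_prod_right
    (f := fun (z : ℂ) (t : ℝ) => f t * conj (timeFreqShift z g t)) ?_
  refine StronglyMeasurable.mul ((Lp.stronglyMeasurable f).comp_measurable measurable_snd) ?_
  refine RCLike.continuous_conj.comp_stronglyMeasurable ?_
  refine StronglyMeasurable.mul (Continuous.stronglyMeasurable (by fun_prop)) ?_
  exact (Lp.stronglyMeasurable g).comp_measurable (by fun_prop)

theorem stft_eq_fourierIntegral (g f : L2) {f₀ : ℝ → ℂ} (hf : f =ᵐ[volume] f₀) (x ξ : ℝ) :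
    stft g f ⟨x, ξ⟩ = ∫ t : ℝ, Complex.exp (-(2 * Real.pi * Complex.I * ξ * t)) *
      (f₀ t * conj (g (t - x))) := by
  refine integral_congr_ae ?_
  filter_upwards [hf] with t ht
  simp only [timeFreqShift, ht, map_mul, ← Complex.exp_conj, Complex.conj_ofReal, Complex.conj_I,
    map_ofNat]
  rw [mul_left_comm]
  congr 2
  ring

theorem lintegral_enorm_sq_eq_norm_sq (f : L2) :
    ∫⁻ t, ‖f t‖ₑ ^ 2 = ENNReal.ofReal (‖f‖ ^ 2) := by
  have h := eLpNorm_nnreal_pow_eq_lintegral (p := 2) (μ := volume) (f := f) (by simp)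
  rw [Lp.norm_def, ENNReal.ofReal_pow ENNReal.toReal_nonneg,
    ENNReal.ofReal_toReal (Lp.eLpNorm_ne_top f)]
  simpa using h.symm

/-- Moyal's identity for a continuous compactly supported signal. -/
theorem lintegral_enorm_sq_stft (g f : L2) {f₀ : ℝ → ℂ} (hf : f =ᵐ[volume] f₀)
    (hcont : Continuous f₀) (hcs : HasCompactSupport f₀) :
    ∫⁻ z : ℂ, ‖stft g f z‖ₑ ^ 2 = ENNReal.ofReal (‖f‖ ^ 2 * ‖g‖ ^ 2) := by
  obtain ⟨M, hM⟩ := hcs.exists_bound_of_continuous hcont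
  obtain ⟨r, hr⟩ := hcs.isCompact.isBounded.subset_closedBall 0
  -- `|r|` is used because the radius has no sign; the margin 1 makes the half-open interval
  -- nondegenerate and covers both endpoints.
  have hsupp : ∀ t, t ∉ Set.Ioc (-|r| - 1) (|r| + 1) → f₀ t = 0 := by
    intro t ht
    by_contra hne
    have h1 := hr (subset_tsupport _ hne)
    rw [mem_closedBall_zero_iff, Real.norm_eq_abs] at h1
    have h2 := abs_le.1 (h1.trans (le_abs_self r))
    exact ht ⟨by linarith, by linarith⟩
  have hinner : ∀ x : ℝ, ∫⁻ ξ : ℝ, ‖stft g f ⟨x, ξ⟩‖ₑ ^ 2 =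
      ∫⁻ t, ‖f₀ t‖ₑ ^ 2 * ‖g (t - x)‖ₑ ^ 2 := by
    intro x
    have hsm : StronglyMeasurable fun t => conj (g (t - x)) :=
      RCLike.continuous_conj.comp_stronglyMeasurable
        ((Lp.stronglyMeasurable g).comp_measurable (by fun_prop))
    have hg2 : MemLp (fun t => M * ‖g (t - x)‖) 2 volume :=
      ((Lp.memLp g).comp_measurePreserving (measurePreserving_sub_right volume x)).norm.const_mul M
    simp_rw [stft_eq_fourierIntegral g f hf]
    rw [lintegral_enorm_sq_fourierIntegral (F := fun t => f₀ t * conj (g (t - x)))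
      (a := -|r| - 1) (b := |r| + 1)
      (hcont.stronglyMeasurable.mul hsm) ?_ (by linarith [abs_nonneg r])
      (fun t ht => by simp [hsupp t ht])]
    · simp [mul_pow]
    · refine hg2.of_le (hcont.stronglyMeasurable.mul hsm).aestronglyMeasurable
        (ae_of_all _ fun t => ?_)
      simp only [norm_mul, RCLike.norm_conj, norm_norm]
      gcongr
      exact (hM t).trans (le_abs_self M)
  have hm : Measurable fun z : ℂ => ‖stft g f z‖ₑ ^ 2 := (measurable_stft g f).enorm.pow_const 2
  calc ∫⁻ z : ℂ, ‖stft g f z‖ₑ ^ 2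
      = ∫⁻ q : ℝ × ℝ, ‖stft g f ⟨q.1, q.2⟩‖ₑ ^ 2 :=
        (Complex.volume_preserving_equiv_real_prod.symm.lintegral_comp hm).symm
    _ = ∫⁻ x : ℝ, ∫⁻ ξ : ℝ, ‖stft g f ⟨x, ξ⟩‖ₑ ^ 2 := by
        rw [Measure.volume_eq_prod]
        exact lintegral_prod _
          (hm.comp Complex.measurableEquivRealProd.symm.measurable).aemeasurable
    _ = ∫⁻ x : ℝ, ∫⁻ t, ‖f₀ t‖ₑ ^ 2 * ‖g (t - x)‖ₑ ^ 2 := by simp_rw [hinner]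
    _ = ∫⁻ t, ∫⁻ x : ℝ, ‖f₀ t‖ₑ ^ 2 * ‖g (t - x)‖ₑ ^ 2 := by
        refine lintegral_lintegral_swap (Measurable.aemeasurable ?_)
        have h1 : Measurable g := (Lp.stronglyMeasurable g).measurable
        have h2 : Measurable f₀ := hcont.measurable
        simp only [Function.uncurry_def]
        fun_prop
    _ = ∫⁻ t, ‖f₀ t‖ₑ ^ 2 * ∫⁻ s, ‖g s‖ₑ ^ 2 := by
        have h1 : Measurable g := (Lp.stronglyMeasurable g).measurable
        refine lintegral_congr fun t => ?_
        rw [lintegral_const_mul _ (by fun_prop),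
          lintegral_sub_left_eq_self (fun s => ‖g s‖ₑ ^ 2) t]
    _ = ENNReal.ofReal (‖f‖ ^ 2 * ‖g‖ ^ 2) := by
        rw [lintegral_mul_const _ (hcont.measurable.enorm.pow_const 2),
          ENNReal.ofReal_mul (by positivity), lintegral_enorm_sq_eq_norm_sq g,
          ← lintegral_enorm_sq_eq_norm_sq f]
        congr 1
        refine lintegral_congr_ae ?_
        filter_upwards [hf] with t ht
        rw [ht]

/-- Because shifts are isometric, `‖π(w)f - f‖² = 2‖f‖² - 2 Re ⟪π(w)f, f⟫`, and the inner product is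
continuous in `w` by dominated convergence. -/
theorem tendsto_shiftL2 (f : L2) {f₀ : ℝ → ℂ} (hf : f =ᵐ[volume] f₀)
    (hcont : Continuous f₀) (hcs : HasCompactSupport f₀) :
    Filter.Tendsto (fun w => shiftL2 w f) (𝓝 0) (𝓝 f) := by
  obtain ⟨M, hM⟩ := hcs.exists_bound_of_continuous hcont
  have hst : ∀ w, ⟪shiftL2 w f, f⟫_ℂ = ∫ t, f₀ t * conj (timeFreqShift w f₀ t) := fun w => by
    rw [← stft_eq_inner]
    refine integral_congr_ae ?_
    filter_upwards [hf, timeFreqShift_congr_ae w hf] with t h1 h2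
    rw [h1, h2]
  have hc : Continuous fun w => ⟪shiftL2 w f, f⟫_ℂ := by
    simp_rw [hst]
    refine continuous_of_dominated (bound := fun t => ‖f₀ t‖ * M) (fun w => ?_) (fun w => ?_) ?_ ?_
    · exact Continuous.aestronglyMeasurable (by unfold timeFreqShift; fun_prop)
    · refine ae_of_all _ fun t => ?_
      rw [norm_mul, RCLike.norm_conj, norm_timeFreqShift]
      gcongr
      exact hM _
    · exact (hcont.integrable_of_hasCompactSupport hcs).norm.mul_const M
    · exact ae_of_all _ fun t => by unfold timeFreqShift; fun_prop
  rw [tendsto_iff_norm_sub_tendsto_zero]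
  have hsq : ∀ w, ‖shiftL2 w f - f‖ = Real.sqrt (2 * ‖f‖ ^ 2 - 2 * (⟪shiftL2 w f, f⟫_ℂ).re) := by
    intro w
    have h := norm_sub_sq (𝕜 := ℂ) (shiftL2 w f) f
    rw [LinearIsometry.norm_map, RCLike.re_eq_complex_re] at h
    rw [← Real.sqrt_sq (norm_nonneg (shiftL2 w f - f)), h]
    congr 1
    ring
  have hlim : Continuous fun w => ‖shiftL2 w f - f‖ := by
    simp_rw [hsq]
    fun_prop
  have := hlim.tendsto 0
  rwa [shiftL2_zero, sub_self, norm_zero] at this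

/-! ### Geometry of the thickened lattice -/

/-- The square `[0, r] + i[0, r]`. -/
def cell (r : ℝ) : Set ℂ := Set.Icc 0 r ×ℂ Set.Icc 0 r

theorem measurableSet_cell (r : ℝ) : MeasurableSet (cell r) :=
  (Complex.measurable_re measurableSet_Icc).inter (Complex.measurable_im measurableSet_Icc)

theorem volume_reProdIm_Icc (a b c d : ℝ) :
    (volume : Measure ℂ) (Set.Icc a b ×ℂ Set.Icc c d) =
      ENNReal.ofReal (b - a) * ENNReal.ofReal (d - c) := by
  have h := Complex.volume_preserving_equiv_real_prod.measure_preimage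
    (s := Set.Icc a b ×ˢ Set.Icc c d)
    (measurableSet_Icc.prod measurableSet_Icc).nullMeasurableSet
  rw [Measure.volume_eq_prod, Measure.prod_prod, Real.volume_Icc, Real.volume_Icc] at h
  exact h

theorem volume_cell {r : ℝ} (hr : 0 ≤ r) :
    (volume : Measure ℂ) (cell r) = ENNReal.ofReal (r ^ 2) := by
  rw [cell, volume_reProdIm_Icc, sub_zero, ← ENNReal.ofReal_mul hr, sq]

/-- The union of the squares of side length `r` attached to the points of `2ℤ + iℤ`. -/
def latticeCells (r : ℝ) : Set ℂ := ⋃ p : ℤ × ℤ, (fun w => w - latticePoint p) ⁻¹' cell r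

theorem measurableSet_translate_cell (r : ℝ) (z : ℂ) :
    MeasurableSet ((fun w => w - z) ⁻¹' cell r) :=
  (measurable_sub_const z) (measurableSet_cell r)

theorem volume_translate_cell {r : ℝ} (hr : 0 ≤ r) (z : ℂ) :
    (volume : Measure ℂ) ((fun w => w - z) ⁻¹' cell r) = ENNReal.ofReal (r ^ 2) := by
  rw [(measurePreserving_sub_right volume z).measure_preimage
    (measurableSet_cell r).nullMeasurableSet, volume_cell hr]

theorem measurableSet_latticeCells (r : ℝ) : MeasurableSet (latticeCells r) :=
  MeasurableSet.iUnion fun _ => measurableSet_translate_cell r _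

theorem mem_translate_square (z w : ℂ) (R : ℝ) :
    w ∈ (fun w => z + w) '' square R ↔ |w.re - z.re| ≤ R / 2 ∧ |w.im - z.im| ≤ R / 2 := by
  constructor
  · rintro ⟨v, hv, rfl⟩
    simpa [square] using hv
  · intro h
    refine ⟨w - z, ?_, by ring⟩
    simpa [square] using h

theorem volume_translate_square_lt_top (z : ℂ) (R : ℝ) :
    (volume : Measure ℂ) ((fun w => z + w) '' square R) < ∞ := by
  refine (measure_mono (t := Set.Icc (z.re - R / 2) (z.re + R / 2) ×ℂ
    Set.Icc (z.im - R / 2) (z.im + R / 2)) fun w hw => ?_).trans_lt ?_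
  · rw [mem_translate_square] at hw
    have h1 := abs_le.1 hw.1
    have h2 := abs_le.1 hw.2
    exact ⟨⟨by linarith, by linarith⟩, ⟨by linarith, by linarith⟩⟩
  · rw [volume_reProdIm_Icc]
    exact ENNReal.mul_lt_top ENNReal.ofReal_lt_top ENNReal.ofReal_lt_top

theorem sq_le_volume_latticeCells_inter {r R : ℝ} (hr : 0 ≤ r) (hrR : r + 2 ≤ R) (z : ℂ) :
    r ^ 2 ≤ (volume : Measure ℂ).real (latticeCells r ∩ (fun w => z + w) '' square R) := by
  -- The first lattice point above and to the right of the lower left corner of the square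
  -- overshoots by less than 2 and 1, so its cell fits when `r + 2 ≤ R`.
  set p : ℤ × ℤ := (⌈(z.re - R / 2) / 2⌉, ⌈z.im - R / 2⌉) with hp
  have h1 : ((fun w => w - latticePoint p) ⁻¹' cell r) ⊆
      latticeCells r ∩ (fun w => z + w) '' square R := by
    intro w hw
    refine ⟨Set.mem_iUnion.2 ⟨p, hw⟩, ?_⟩
    obtain ⟨⟨hw1, hw2⟩, hw3, hw4⟩ := hw
    simp only [Complex.sub_re, Complex.sub_im, latticePoint, hp] at hw1 hw2 hw3 hw4
    have a1 := Int.le_ceil ((z.re - R / 2) / 2)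
    have a2 := Int.ceil_lt_add_one ((z.re - R / 2) / 2)
    have a3 := Int.le_ceil (z.im - R / 2)
    have a4 := Int.ceil_lt_add_one (z.im - R / 2)
    rw [mem_translate_square, abs_le, abs_le]
    refine ⟨⟨?_, ?_⟩, ?_, ?_⟩ <;> linarith
  have h2 : (volume : Measure ℂ).real ((fun w => w - latticePoint p) ⁻¹' cell r) = r ^ 2 := by
    rw [Measure.real, volume_translate_cell hr, ENNReal.toReal_ofReal (by positivity)]
  rw [← h2]
  exact measureReal_mono h1
    ((measure_mono Set.inter_subset_right).trans_lt (volume_translate_square_lt_top z R)).ne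

/-- A crude count suffices: the bound serves only to make `γ` tend to 0 with `r`. -/
theorem volume_latticeCells_inter_square_le {r R : ℝ} (hr : 0 ≤ r) (hr1 : r ≤ 1) (hR : 2 ≤ R) :
    (volume : Measure ℂ).real (latticeCells r ∩ (fun w => (0 : ℂ) + w) '' square R) ≤
      (Finset.Icc (-⌈R⌉) ⌈R⌉ ×ˢ Finset.Icc (-⌈R⌉) ⌈R⌉).card * r ^ 2 := by
  set s := Finset.Icc (-⌈R⌉) ⌈R⌉ ×ˢ Finset.Icc (-⌈R⌉) ⌈R⌉
  have h1 : latticeCells r ∩ (fun w => (0 : ℂ) + w) '' square R ⊆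
      ⋃ p ∈ s, (fun w => w - latticePoint p) ⁻¹' cell r := by
    rintro w ⟨hw, hwR⟩
    obtain ⟨p, hp⟩ := Set.mem_iUnion.1 hw
    refine Set.mem_iUnion₂.2 ⟨p, ?_, hp⟩
    obtain ⟨⟨hw1, hw2⟩, hw3, hw4⟩ := hp
    rw [mem_translate_square, abs_le, abs_le] at hwR
    obtain ⟨⟨b1, b2⟩, b3, b4⟩ := hwR
    simp only [Complex.sub_re, Complex.sub_im, latticePoint, Complex.zero_re, Complex.zero_im]
      at *
    have a1 := Int.le_ceil R
    simp only [s, Finset.mem_product, Finset.mem_Icc]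
    refine ⟨⟨?_, ?_⟩, ?_, ?_⟩ <;> (rify; linarith)
  calc (volume : Measure ℂ).real (latticeCells r ∩ (fun w => (0 : ℂ) + w) '' square R)
      ≤ (ENNReal.ofReal (s.card * r ^ 2)).toReal := by
        refine ENNReal.toReal_mono ENNReal.ofReal_ne_top ((measure_mono h1).trans ?_)
        refine (measure_biUnion_finset_le _ _).trans (le_of_eq ?_)
        simp_rw [volume_translate_cell hr]
        rw [Finset.sum_const, nsmul_eq_mul, ENNReal.ofReal_mul (by positivity),
          ENNReal.ofReal_natCast]
    _ = s.card * r ^ 2 := ENNReal.toReal_ofReal (by positivity)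

/-! ### Lower bound for the sampling constant -/

/-- The short-time Fourier transform over `latticeCells r` is controlled by the analysis operator
on the shifts of the signal by the points of `cell r`. -/
theorem lintegral_latticeCells_le (g f : L2) (T : L2 →L[ℂ] lp (fun _ : ℤ × ℤ => ℂ) 2)
    (hT : ∀ f, ∑' p, ‖⟪shiftL2 (latticePoint p) g, f⟫_ℂ‖ₑ ^ 2 = ENNReal.ofReal (‖T f‖ ^ 2))
    {r c : ℝ} (hr : 0 ≤ r) (hc : ∀ w ∈ cell r, ‖T (shiftL2 (-w) f)‖ ^ 2 ≤ c) :
    ∫⁻ z in latticeCells r, ‖stft g f z‖ₑ ^ 2 ≤ ENNReal.ofReal c * ENNReal.ofReal (r ^ 2) := by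
  have hm : Measurable fun z : ℂ => ‖stft g f z‖ₑ ^ 2 := (measurable_stft g f).enorm.pow_const 2
  calc ∫⁻ z in latticeCells r, ‖stft g f z‖ₑ ^ 2
      ≤ ∑' p : ℤ × ℤ, ∫⁻ z in (fun w => w - latticePoint p) ⁻¹' cell r, ‖stft g f z‖ₑ ^ 2 :=
        lintegral_iUnion_le _ _
    _ = ∑' p : ℤ × ℤ, ∫⁻ w in cell r, ‖stft g f (latticePoint p + w)‖ₑ ^ 2 := by
        refine tsum_congr fun p => ?_
        have h := (measurePreserving_sub_right volume (latticePoint p)).setLIntegral_comp_preimage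
          (measurableSet_cell r) (hm.comp (measurable_const_add (latticePoint p)))
        simpa using h
    _ = ∫⁻ w in cell r, ∑' p : ℤ × ℤ, ‖stft g f (latticePoint p + w)‖ₑ ^ 2 :=
        (lintegral_tsum fun p =>
          (hm.comp (measurable_const_add (latticePoint p))).aemeasurable).symm
    _ ≤ ∫⁻ w in cell r, ENNReal.ofReal c := by
        refine setLIntegral_mono measurable_const fun w hw => ?_
        have h1 : ∀ p, ‖stft g f (latticePoint p + w)‖ₑ =
            ‖⟪shiftL2 (latticePoint p) g, shiftL2 (-w) f⟫_ℂ‖ₑ := fun p => by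
          rw [← ofReal_norm, norm_stft_add, ofReal_norm]
        simp_rw [h1]
        rw [hT]
        exact ENNReal.ofReal_le_ofReal (hc w hw)
    _ = ENNReal.ofReal c * ENNReal.ofReal (r ^ 2) := by
        rw [setLIntegral_const, volume_cell hr]

/-- The sampling constants of `(γ, R)`-dense sets are not `O(γ⁻¹)`. -/
theorem exists_le_samplingConstant (g : L2) (hg : g ≠ 0)
    (hB : ∀ Γ : Set ℂ, IsRelativelyUniformlySeparated Γ → IsGaborBessel g Γ)
    (R : ℝ) (hR : 2 < R)
    (hS : ∀ (γ : ℝ) (Ω : Set ℂ), IsGammaDense γ R Ω → IsPlanarSamplingSet g Ω)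
    {K δ : ℝ} (hK : 0 < K) (hδ : 0 < δ) :
    ∃ (γ : ℝ) (Ω : Set ℂ), γ < δ ∧ IsGammaDense γ R Ω ∧ K * γ⁻¹ ≤ samplingConstant g Ω := by
  obtain ⟨T, hT, hT2⟩ := exists_gaborAnalysis g hB
  have hgpos : 0 < ‖g‖ := norm_pos_iff.2 hg
  have hR0 : 0 < R := by linarith
  -- Chosen so that `‖g‖² / (A R²) = K`, the final lower bound for `C γ`.
  set A := ‖g‖ ^ 2 / (K * R ^ 2) with hA
  have hApos : 0 < A := by positivity
  obtain ⟨f, f₀, hf, hcont, hcs, hlt⟩ := exists_hasCompactSupport_norm_analysis_lt g T hT hApos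
  have hfpos : 0 < ‖f‖ ^ 2 := by
    have h := (sq_nonneg ‖T f‖).trans_lt hlt
    exact pos_of_mul_pos_right h hApos.le
  have hev : ∀ᶠ w in 𝓝 (0 : ℂ), ‖T (shiftL2 (-w) f)‖ ^ 2 < A * ‖f‖ ^ 2 := by
    have h1 : Filter.Tendsto (fun w : ℂ => shiftL2 (-w) f) (𝓝 0) (𝓝 f) :=
      (tendsto_shiftL2 f hf hcont hcs).comp (by simpa using (continuous_neg (G := ℂ)).tendsto 0)
    exact (((T.continuous.tendsto f).comp h1).norm.pow 2).eventually_lt_const hlt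
  obtain ⟨η, hη, hball⟩ := Metric.eventually_nhds_iff.1 hev
  set N := ((Finset.Icc (-⌈R⌉) ⌈R⌉ ×ˢ Finset.Icc (-⌈R⌉) ⌈R⌉).card : ℝ)
  -- The conditions serve, in order, the cell count, the fit of a cell inside `Q_R`, the bound `|w|
  -- ≤ 2r < η` on `cell r`, and `γ < δ`.
  have hsmall : ∀ᶠ r in 𝓝[>] (0 : ℝ),
      r < 1 ∧ r < R - 2 ∧ 2 * r < η ∧ N * r ^ 2 / R ^ 2 < δ ∧ 0 < r := by
    have hlim : ∀ {φ : ℝ → ℝ} {c : ℝ}, Continuous φ → φ 0 < c → ∀ᶠ r in 𝓝[>] (0 : ℝ), φ r < c :=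
      fun hφ hc => nhdsWithin_le_nhds ((hφ.tendsto 0).eventually_lt_const hc)
    refine (hlim continuous_id one_pos).and <| (hlim continuous_id (sub_pos.2 hR)).and <|
      (hlim (by fun_prop) (by simpa using hη)).and <|
      (hlim (by fun_prop) (by simpa using hδ)).and ?_
    exact self_mem_nhdsWithin
  obtain ⟨r, hr1, hrR, hrη, hrδ, hr⟩ := hsmall.exists
  set γ := ⨅ z : ℂ, (volume : Measure ℂ).real
    (latticeCells r ∩ (fun w => z + w) '' square R) / R ^ 2 with hγ
  have hγlow : r ^ 2 / R ^ 2 ≤ γ := le_ciInf fun z => by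
    gcongr
    exact sq_le_volume_latticeCells_inter hr.le (by linarith) z
  have hγpos : 0 < γ := lt_of_lt_of_le (by positivity) hγlow
  have hγδ : γ < δ := by
    refine (ciInf_le ⟨0, ?_⟩ (0 : ℂ)).trans_lt (lt_of_le_of_lt ?_ hrδ)
    · rintro _ ⟨z, rfl⟩
      positivity
    · gcongr
      exact volume_latticeCells_inter_square_le hr.le hr1.le hR.le
  have hdense : IsGammaDense γ R (latticeCells r) := ⟨measurableSet_latticeCells r, hγ, hγpos⟩
  -- The sampling hypothesis makes the set of bounds nonempty; otherwise its `sInf` would have the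
  -- default value 0.
  refine ⟨γ, latticeCells r, hγδ, hdense, le_csInf (hS _ _ hdense) ?_⟩
  rintro C ⟨hC, hbound⟩
  have h1 : ∫⁻ z in latticeCells r, ‖stft g f z‖ₑ ^ 2 ≤
      ENNReal.ofReal (A * ‖f‖ ^ 2) * ENNReal.ofReal (r ^ 2) := by
    refine lintegral_latticeCells_le g f T hT2 hr.le fun w hw => (hball ?_).le
    obtain ⟨⟨a1, a2⟩, a3, a4⟩ := hw
    rw [dist_zero_right]
    refine (Complex.norm_le_abs_re_add_abs_im w).trans_lt ?_
    rw [abs_of_nonneg a1, abs_of_nonneg a3]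
    linarith
  have h2 := (hbound f).trans (mul_le_mul_right h1 _)
  rw [lintegral_enorm_sq_stft g f hf hcont hcs, ← ENNReal.ofReal_mul (by positivity),
    ← ENNReal.ofReal_mul hC.le, ENNReal.ofReal_le_ofReal_iff (by positivity)] at h2
  have h3 : ‖g‖ ^ 2 ≤ C * (A * r ^ 2) := by
    refine le_of_mul_le_mul_left ?_ hfpos
    linarith
  have h4 : K * R ^ 2 ≤ C * r ^ 2 := by
    have h5 : A * (K * R ^ 2) = ‖g‖ ^ 2 := by rw [hA]; field_simp
    refine le_of_mul_le_mul_left ?_ hApos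
    linarith
  rw [← div_eq_mul_inv, div_le_iff₀ hγpos]
  calc K ≤ C * (r ^ 2 / R ^ 2) := by
        rw [← mul_div_assoc, le_div_iff₀ (by positivity)]
        exact h4
    _ ≤ C * γ := by gcongr

end PlanarSampling

end

theorem mainTheorem7 (g : PlanarSampling.L2) (hg : g ≠ 0)
    (hB : ∀ Γ : Set ℂ, PlanarSampling.IsRelativelyUniformlySeparated Γ →
      PlanarSampling.IsGaborBessel g Γ)
    (R : ℝ) (hR : 2 < R)
    (hS : ∀ (γ : ℝ) (Ω : Set ℂ), PlanarSampling.IsGammaDense γ R Ω →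
      PlanarSampling.IsPlanarSamplingSet g Ω) :
    (¬ ∃ K : ℝ, 0 < K ∧ ∀ (γ : ℝ) (Ω : Set ℂ), PlanarSampling.IsGammaDense γ R Ω →
      PlanarSampling.samplingConstant g Ω ≤ K * γ⁻¹) ∧
    (∀ K δ : ℝ, 0 < K → 0 < δ → ∃ (γ : ℝ) (Ω : Set ℂ), γ < δ ∧
      PlanarSampling.IsGammaDense γ R Ω ∧
      ∃ ε : ℝ, 0 < ε ∧ K * γ ^ (-1 - ε) ≤ PlanarSampling.samplingConstant g Ω) := by
  constructor
  · rintro ⟨K, hK, hle⟩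
    obtain ⟨γ, Ω, -, hdense, hC⟩ := PlanarSampling.exists_le_samplingConstant g hg hB R hR hS
      (K := 2 * K) (by positivity) one_pos
    have h1 := hC.trans (hle γ Ω hdense)
    have h2 : 0 < K * γ⁻¹ := mul_pos hK (inv_pos.2 hdense.2.2)
    linarith
  · intro K δ hK hδ
    -- The spare factor 2 is spent on the exponent: `ε = log 2 / (-log γ)` gives `γ^(-ε) = 2`.
    -- Requiring `γ < 1` as well makes this `ε` positive.
    obtain ⟨γ, Ω, hγ, hdense, hC⟩ := PlanarSampling.exists_le_samplingConstant g hg hB R hR hS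
      (K := 2 * K) (by positivity) (lt_min hδ one_pos)
    have hγ0 : 0 < γ := hdense.2.2
    have hlog : Real.log γ < 0 := Real.log_neg hγ0 (hγ.trans_le (min_le_right _ _))
    refine ⟨γ, Ω, hγ.trans_le (min_le_left _ _), hdense, Real.log 2 / -Real.log γ,
      div_pos (Real.log_pos one_lt_two) (neg_pos.2 hlog), le_trans (le_of_eq ?_) hC⟩
    have h2 : γ ^ (-(Real.log 2 / -Real.log γ)) = 2 := by
      rw [Real.rpow_def_of_pos hγ0, mul_neg, ← neg_mul, mul_div_cancel₀ _ (neg_pos.2 hlog).ne',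
        Real.exp_log two_pos]
    rw [sub_eq_add_neg, Real.rpow_add hγ0, h2, Real.rpow_neg_one]
    ring
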